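/- Let $V$ be a complex inner product space of finite dimension $n>1$ with an orthonormal basis $e_1,\dots,e_n$, let $m\ge 0$, and let $V^{\otimes m}$ carry the induced inner product, $\langle v_1\otimes\cdots\otimes v_m,\,u_1\otimes\cdots\otimes u_m\rangle=\prod_{i}\langle v_i,u_i\rangle$. Let $G$ be a subgroup of the symmetric group $S_m$ and let $\chi$ be an irreducible complex character of $G$. For $\sigma\in G$ let $P_\sigma$ be the linear operator on $V^{\otimes m}$ with $P_\sigma(v_1\otimes\cdots\otimes v_m)=v_{\sigma^{-1}(1)}\otimes\cdots\otimes v_{\sigma^{-1}(m)}$, put $$T(G,\chi)=\frac{\chi(e)}{|G|}\sum_{\sigma\in G}\chi(\sigma)P_\sigma ,$$ and let the symmetry class of tensors $V_\chi(G)$ be the image of $T(G,\chi)$. Let $\Gamma_{m,n}$ be the set of all sequences $\alpha=(\alpha_1,\dots,\alpha_m)$ with $1\le\alpha_i\le n$; for $\alpha\in\Gamma_{m,n}$ let $e^*_\alpha=T(G,\chi)(e_{\alpha_1}\otimes\cdots\otimes e_{\alpha_m})$ and $G_\alpha=\{\sigma\in G : \alpha_{\sigma^{-1}(i)}=\alpha_i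 \text{ for all } i\}$. An o*-basis of $V_\chi(G)$ is an orthogonal basis of $V_\chi(G)$ that consists of tensors of the form $e^*_\alpha$, $\alpha\in\Gamma_{m,n}$ (the empty set if $V_\chi(G)=0$). Suppose that at least one of the following holds: 1. $G$ is isomorphic to the dihedral group $D_{2s}$ of order $2s$ for some odd $s$; 2. $G$ is a non-abelian group of order $pq$ with $p,q$ prime; 3. $G$ is a $Z$-group (all its Sylow subgroups are cyclic), $|G|$ has exactly two distinct prime divisors, and $G_\alpha=\{e\}$ for some $\alpha\in\Gamma_{m,n}$. Then $V_\chi(G)$ admits an o*-basis if and only if $\chi$ is linear, i.e. $\chi(e)=1$. -/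

import Mathlib

open scoped TensorProduct

noncomputable section

namespace SymTensor

variable {V : Type*} [NormedAddCommGroup V] [InnerProductSpace ℂ V] {n m : ℕ}

/-- The `m`-fold tensor power `V ⊗ ⋯ ⊗ V`. -/
abbrev TensorPower (V : Type*) [NormedAddCommGroup V] [InnerProductSpace ℂ V] (m : ℕ) : Type _ :=
  ⨂[ℂ] _ : Fin m, V

/-- The induced inner product on the tensor power, conjugate-linear in the first variable: the
coordinates are those with respect to the tensors `e_{α₁} ⊗ ⋯ ⊗ e_{αₘ}`, which are thereby
orthonormal. By `tensorInner_tprod` it is the standard one, and does not depend on the choice of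
the orthonormal basis. -/
def tensorInner (b : OrthonormalBasis (Fin n) ℂ V) (x y : TensorPower V m) : ℂ :=
  ∑ α : Fin m → Fin n,
    starRingEnd ℂ ((Basis.piTensorProduct fun _ : Fin m => b.toBasis).repr x α) *
      (Basis.piTensorProduct fun _ : Fin m => b.toBasis).repr y α

theorem tensorInner_tprod (b : OrthonormalBasis (Fin n) ℂ V) (v u : Fin m → V) :
    tensorInner b (PiTensorProduct.tprod ℂ v) (PiTensorProduct.tprod ℂ u) =
      ∏ i, inner ℂ (v i) (u i) := by
  have h : ∀ i, inner ℂ (v i) (u i) =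
      ∑ j : Fin n, starRingEnd ℂ (b.repr (v i) j) * b.repr (u i) j := by
    intro i
    rw [← b.repr.inner_map_map, PiLp.inner_apply]
    exact Finset.sum_congr rfl fun j _ => by simp [mul_comm]
  simp only [h, Finset.prod_univ_sum, Fintype.piFinset_univ]
  simp [tensorInner, Basis.piTensorProduct_repr_tprod_apply, Finset.prod_mul_distrib]

/-- `P_σ (v₁ ⊗ ⋯ ⊗ vₘ) = v_{σ⁻¹(1)} ⊗ ⋯ ⊗ v_{σ⁻¹(m)}`. -/
def permOp (V : Type*) [NormedAddCommGroup V] [InnerProductSpace ℂ V] (σ : Equiv.Perm (Fin m)) :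
    Module.End ℂ (TensorPower V m) :=
  (PiTensorProduct.reindex ℂ (fun _ : Fin m => V) σ).toLinearMap

theorem permOp_tprod (σ : Equiv.Perm (Fin m)) (v : Fin m → V) :
    permOp V σ (PiTensorProduct.tprod ℂ v) = PiTensorProduct.tprod ℂ fun i => v (σ⁻¹ i) :=
  PiTensorProduct.reindex_tprod σ v

/-- `χ` is the character of an irreducible complex representation of `G`. -/
def IsIrreducibleCharacter {G : Type*} [Group G] (χ : G → ℂ) : Prop :=
  ∃ (d : ℕ) (ρ : Representation ℂ G (Fin d → ℂ)), ρ.IsIrreducible ∧ ρ.character = χ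

/-- A linear character is one of degree one. -/
def IsLinearCharacter {G : Type*} [Group G] (χ : G → ℂ) : Prop :=
  χ 1 = 1

/-- The symmetry operator `T(G, χ) = χ(e)/|G| ∑_{σ ∈ G} χ(σ) P_σ`. -/
def symmetrizer (V : Type*) [NormedAddCommGroup V] [InnerProductSpace ℂ V]
    (G : Subgroup (Equiv.Perm (Fin m))) (χ : G → ℂ) : Module.End ℂ (TensorPower V m) :=
  haveI : Fintype G := Fintype.ofFinite G
  (χ 1 / (Nat.card G : ℂ)) • ∑ σ : G, χ σ • permOp V (σ : Equiv.Perm (Fin m))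

/-- The symmetry class of tensors `V_χ(G)`. -/
def symmetryClass (V : Type*) [NormedAddCommGroup V] [InnerProductSpace ℂ V]
    (G : Subgroup (Equiv.Perm (Fin m))) (χ : G → ℂ) : Submodule ℂ (TensorPower V m) :=
  LinearMap.range (symmetrizer V G χ)

/-- The decomposable symmetrized tensor `e*_α = T(G, χ)(e_{α₁} ⊗ ⋯ ⊗ e_{αₘ})`. -/
def starTensor (b : OrthonormalBasis (Fin n) ℂ V) (G : Subgroup (Equiv.Perm (Fin m)))
    (χ : G → ℂ) (α : Fin m → Fin n) : TensorPower V m :=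
  symmetrizer V G χ (PiTensorProduct.tprod ℂ fun i => b (α i))

/-- `V_χ(G)` admits an o*-basis: an orthogonal basis consisting of tensors `e*_α`. -/
def HasOStarBasis (b : OrthonormalBasis (Fin n) ℂ V) (G : Subgroup (Equiv.Perm (Fin m)))
    (χ : G → ℂ) : Prop :=
  ∃ S : Set (Fin m → Fin n),
    LinearIndepOn ℂ (starTensor b G χ) S ∧
    Submodule.span ℂ (starTensor b G χ '' S) = symmetryClass V G χ ∧
    S.Pairwise fun α β => tensorInner b (starTensor b G χ α) (starTensor b G χ β) = 0

/-- The stabilizer `G_α = {σ ∈ G | ασ = α}`, where `ασ = (α_{σ⁻¹(1)}, …, α_{σ⁻¹(m)})`. -/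
def stabilizer (G : Subgroup (Equiv.Perm (Fin m))) (α : Fin m → Fin n) :
    Set (Equiv.Perm (Fin m)) :=
  {σ | σ ∈ G ∧ (fun i => α (σ⁻¹ i)) = α}

end SymTensor

end

/-! In all three cases `G` has a normal cyclic subgroup `⟨c⟩` with cyclic quotient: the rotations of
a dihedral group, or the commutator subgroup of a `Z`-group. Let `ρ`, of degree `d`, afford `χ`, and
let `T` be the normal subgroup of elements acting by operators that commute with `ρ c`.

By Clifford theory `χ` vanishes off `T` (`character_eq_zero`) and `ρ` is induced from a linear
character of `T`, so `d = [G : T]` (`finrank_eq_index_commuteSubgroup`). For `t ∈ T` some power of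
`ρ t` is scalar, so `χ t` is a nonzero multiple of a sum of `d` roots of unity of order dividing
`orderOf c`. Arithmetic forbids that sum to vanish: either `c` has `p`-power order and `p ∤ d`, or
the order is odd and `d ≤ 2`. Hence `χ` vanishes exactly off `T`.

Suppose also that `T` meets some `G_α` trivially. An o*-basis then contains some `e*_β` with the
same property, and each of its other members is orthogonal to `e*_{tβ}` for `t ∈ T`. So `e*_{tβ}` is
proportional to `e*_β`, and translation by `c` scales `χ` on `T`
(`HasOStarBasis.exists_character_mul`). This makes `ρ c` scalar, whence `T = G` and `d = 1`.
Conversely, for linear `χ` the tensors `e*_α` along an orbit are proportional, and orbit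
representatives suffice. -/

namespace Representation

open Module

variable {G W : Type*} [Group G] [AddCommGroup W] [Module ℂ W] {ρ : Representation ℂ G W}

/-! ### Irreducible representations and cyclic normal subgroups -/

theorem IsIrreducible.eq_top_of_mem [ρ.IsIrreducible] (p : Submodule ℂ W)
    (hp : ∀ g, ∀ w ∈ p, ρ g w ∈ p) {v : W} (hv : v ∈ p) (hv0 : v ≠ 0) : p = ⊤ := by
  rcases eq_bot_or_eq_top (⟨p, fun g w hw => hp g w hw⟩ : Subrepresentation ρ) with h | h
  · refine absurd ?_ hv0
    have h2 : v ∈ (⟨p, fun g w hw => hp g w hw⟩ : Subrepresentation ρ) := hv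
    rw [h] at h2
    exact h2
  · ext w
    have h2 : w ∈ (⊤ : Subrepresentation ρ) := _root_.trivial
    rw [← h] at h2
    exact ⟨fun _ => Submodule.mem_top, fun _ => h2⟩

theorem IsIrreducible.exists_ne_zero [h : ρ.IsIrreducible] : ∃ v : W, v ≠ 0 := by
  by_contra! hW
  obtain ⟨x, y, hxy⟩ := h.toNontrivial
  refine hxy (Subrepresentation.toSubmodule_injective (Submodule.ext fun w => ?_))
  rw [hW w]
  simp

theorem IsIrreducible.exists_eq_smul_one [FiniteDimensional ℂ W] [ρ.IsIrreducible] (f : End ℂ W)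
    (hf : ∀ g, Commute f (ρ g)) : ∃ μ : ℂ, f = μ • (1 : End ℂ W) := by
  obtain ⟨v, hv⟩ := IsIrreducible.exists_ne_zero (ρ := ρ)
  have : Nontrivial W := ⟨⟨v, 0, hv⟩⟩
  obtain ⟨μ, hμ⟩ := Module.End.exists_eigenvalue f
  obtain ⟨w, hw⟩ := hμ.exists_hasEigenvector
  have h := IsIrreducible.eq_top_of_mem (ρ := ρ) (Module.End.eigenspace f μ) (fun g x hx => by
    rw [Module.End.mem_eigenspace_iff] at hx ⊢
    have := congrArg (fun l => l x) (hf g).eq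
    simp only [Module.End.mul_apply] at this
    rw [this, hx, map_smul]) hw.1 hw.2
  refine ⟨μ, LinearMap.ext fun x => ?_⟩
  have hx : x ∈ Module.End.eigenspace f μ := h ▸ Submodule.mem_top
  simpa using Module.End.mem_eigenspace_iff.1 hx

section CyclicNormal

variable [ρ.IsIrreducible] {n : G}

/-- A nonzero vector fixed by an element of a cyclic normal subgroup is fixed by its conjugates,
so that the element acts trivially. -/
theorem IsIrreducible.eq_one_of_fixed (hn : ∀ g : G, g * n * g⁻¹ ∈ Subgroup.zpowers n) {c : G}
    (hc : c ∈ Subgroup.zpowers n) {v : W} (hv : v ≠ 0) (h : ρ c v = v) : ρ c = 1 := by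
  have hz : ∀ (x : G) (w : W), ρ x w = w → ∀ k : ℤ, ρ (x ^ k) w = w := by
    intro x w hx k
    have h1 : ρ x⁻¹ w = w := by
      conv_lhs => rw [← hx]
      rw [← Module.End.mul_apply, ← map_mul]; simp
    induction k using Int.induction_on with
    | zero => simp
    | succ i ih => rw [zpow_add_one, map_mul, Module.End.mul_apply, hx, ih]
    | pred i ih => rw [zpow_sub_one, map_mul, Module.End.mul_apply, h1, ih]
  have htop := IsIrreducible.eq_top_of_mem (ρ := ρ) (LinearMap.ker (ρ c - 1)) (fun g w hw => by
    have hw' : ρ c w = w := by simpa [sub_eq_zero] using hw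
    obtain ⟨k, hk⟩ := Subgroup.mem_zpowers_iff.1 (hn g⁻¹)
    obtain ⟨i, rfl⟩ := Subgroup.mem_zpowers_iff.1 hc
    -- Conjugation acts on `⟨n⟩` as a power map, so it preserves every subgroup of `⟨n⟩`; hence the
    -- fixed space of `ρ c` is `G`-stable.
    have h2 : n ^ i * g = g * (n ^ i) ^ k := by
      have h3 : g⁻¹ * n ^ i * g = (n ^ i) ^ k := by
        rw [← zpow_mul, mul_comm, zpow_mul, hk, inv_inv]
        simpa using (conj_zpow (a := g⁻¹) (b := n) (i := i)).symm
      rw [← h3]; group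
    have h4 : ρ (n ^ i) (ρ g w) = ρ g w := by
      rw [← Module.End.mul_apply, ← map_mul, h2, map_mul, Module.End.mul_apply, hz _ _ hw']
    simp [h4]) (v := v) (by simp [h]) hv
  rwa [LinearMap.ker_eq_top, sub_eq_zero] at htop

/-- Any vector in the image of this sum is fixed by `ρ c`, and a nonzero one would force `ρ c = 1`.
-/
theorem IsIrreducible.sum_pow_eq_zero [Finite G]
    (hn : ∀ g : G, g * n * g⁻¹ ∈ Subgroup.zpowers n) {c : G}
    (hc : c ∈ Subgroup.zpowers n) (h : ρ c ≠ 1) :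
    ∑ j ∈ Finset.range (orderOf c), ρ (c ^ j) = 0 := by
  ext w
  by_contra hw
  refine h (IsIrreducible.eq_one_of_fixed hn hc hw ?_)
  rw [← Module.End.mul_apply, Finset.mul_sum]
  simp only [← map_mul, ← pow_succ']
  congr 1
  have h1 := Finset.sum_range_succ (fun j => ρ (c ^ j)) (orderOf c)
  rw [Finset.sum_range_succ', pow_orderOf_eq_one, pow_zero] at h1
  exact add_right_cancel h1

/-- The commutator `c` of `n` and `g⁻¹` lies in `⟨n⟩` and acts nontrivially, while every `g * c ^ j`
is conjugate to `g` by a power of `n`. Averaging the character over these elements gives the trace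
of `ρ g` times a vanishing sum. -/
theorem IsIrreducible.character_eq_zero [Finite G]
    (hn : ∀ g : G, g * n * g⁻¹ ∈ Subgroup.zpowers n) {g : G} (hg : ¬ Commute (ρ g) (ρ n)) :
    ρ.character g = 0 := by
  have hc : n * (g⁻¹ * n * g)⁻¹ ∈ Subgroup.zpowers n :=
    mul_mem (Subgroup.mem_zpowers n) (inv_mem (by simpa using hn g⁻¹))
  obtain ⟨i, hi⟩ := Subgroup.mem_zpowers_iff.1 (show g⁻¹ * n * g ∈ Subgroup.zpowers n by
    simpa using hn g⁻¹)
  set c := n * (g⁻¹ * n * g)⁻¹ with hcdef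
  have hin : Commute (g⁻¹ * n * g) n := by rw [← hi]; exact (Commute.refl n).zpow_left i
  have h1 : ρ c ≠ 1 := by
    intro h1
    apply hg
    have h2 : n * g = g * n * (c⁻¹) := by
      rw [hcdef, mul_inv_rev, inv_inv, mul_assoc g n, ← mul_assoc n, ← hin.eq]; group
    have h3 : ρ c⁻¹ = 1 := by
      have := map_mul ρ c c⁻¹
      rw [mul_inv_cancel, map_one, h1, one_mul] at this
      exact this.symm
    rw [Commute, SemiconjBy, ← map_mul, ← map_mul, h2, map_mul ρ (g * n), h3, mul_one]
  have h2 : ∀ j : ℕ, ρ.character (g * c ^ j) = ρ.character g := by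
    intro j
    have h3 : g * c ^ j = (n ^ j)⁻¹ * g * n ^ j := by
      have h4 : c ^ j = (g⁻¹ * n * g)⁻¹ ^ j * n ^ j := by
        rw [hcdef, (hin.symm.inv_right).mul_pow]
        exact ((hin.symm.inv_right).pow_pow j j).eq
      have h5 : (g⁻¹ * n * g) ^ j = g⁻¹ * n ^ j * g := by
        simpa using conj_pow (a := g⁻¹) (b := n) (i := j)
      rw [h4, inv_pow, h5]; group
    rw [h3]
    simpa using char_conj (ρ := ρ) g (n ^ j)⁻¹
  have h3 : (orderOf c : ℂ) * ρ.character g = 0 := by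
    calc (orderOf c : ℂ) * ρ.character g
        = ∑ j ∈ Finset.range (orderOf c), ρ.character (g * c ^ j) := by simp [h2]
      _ = LinearMap.trace ℂ W (ρ g * ∑ j ∈ Finset.range (orderOf c), ρ (c ^ j)) := by
        simp [character, Finset.mul_sum]
      _ = 0 := by rw [IsIrreducible.sum_pow_eq_zero hn hc h1]; simp
  simpa [(orderOf_pos c).ne'] using h3

end CyclicNormal

variable (ρ) in
/-- The elements acting by operators that commute with `ρ n`. -/
def commuteSubgroup (n : G) : Subgroup G where
  carrier := {g | Commute (ρ g) (ρ n)}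
  mul_mem' {a b} ha hb := by
    simp only [Set.mem_ofPred_eq, map_mul] at *
    exact ha.mul_left hb
  one_mem' := by simp
  inv_mem' {a} ha := by
    have h1 : ρ a * ρ a⁻¹ = 1 := by simp [← map_mul]
    have h2 : ρ a⁻¹ * ρ a = 1 := by simp [← map_mul]
    have ha' : ρ a * ρ n = ρ n * ρ a := ha
    change ρ a⁻¹ * ρ n = ρ n * ρ a⁻¹
    calc ρ a⁻¹ * ρ n = ρ a⁻¹ * (ρ n * ρ a) * ρ a⁻¹ := by rw [mul_assoc, mul_assoc, h1, mul_one]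
      _ = ρ n * ρ a⁻¹ := by rw [← ha', ← mul_assoc, h2, one_mul]

theorem mem_commuteSubgroup {n g : G} : g ∈ ρ.commuteSubgroup n ↔ Commute (ρ g) (ρ n) := Iff.rfl

theorem zpowers_le_commuteSubgroup (n : G) : Subgroup.zpowers n ≤ ρ.commuteSubgroup n := by
  rw [Subgroup.zpowers_le]
  exact Commute.refl (ρ n)

theorem commute_of_mem_zpowers {n c g : G} (hc : c ∈ Subgroup.zpowers n)
    (hg : g ∈ ρ.commuteSubgroup n) : Commute (ρ g) (ρ c) := by
  have hle : Subgroup.zpowers n ≤ ρ.commuteSubgroup g := by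
    rw [Subgroup.zpowers_le]
    exact (mem_commuteSubgroup.1 hg).symm
  exact (hle hc).symm

theorem commuteSubgroup_conj_mem {n : G} (hn : ∀ g : G, g * n * g⁻¹ ∈ Subgroup.zpowers n) {t : G}
    (ht : t ∈ ρ.commuteSubgroup n) (g : G) : g * t * g⁻¹ ∈ ρ.commuteSubgroup n := by
  have h := commute_of_mem_zpowers (hn g⁻¹) ht
  rw [mem_commuteSubgroup, Commute, SemiconjBy] at *
  have h1 := congrArg (fun x => ρ g * x * ρ g⁻¹) h
  simp only [← map_mul] at h1 ⊢
  convert h1 using 2 <;> group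

end Representation

/-! ### Degree of the representation and character orthogonality -/

namespace Representation

open Module
open scoped ComplexOrder

variable {G W : Type*} [Group G] [AddCommGroup W] [Module ℂ W] {ρ : Representation ℂ G W}

/-- The image of `commuteSubgroup` in the cyclic quotient has a generator, the class of some `y`.
Since `ρ y` and `ρ n` commute they share an eigenvector, and the elements having it as an
eigenvector form a subgroup. -/
theorem exists_common_eigenvector [FiniteDimensional ℂ W] [ρ.IsIrreducible] (n : G)
    [(Subgroup.zpowers n).Normal] [IsCyclic (G ⧸ Subgroup.zpowers n)] :
    ∃ v : W, v ≠ 0 ∧ ∀ t ∈ ρ.commuteSubgroup n, ∃ μ : ℂ, ρ t v = μ • v := by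
  obtain ⟨⟨_, y, hyT, rfl⟩, hy⟩ := IsCyclic.exists_generator
    (α := (ρ.commuteSubgroup n).map (QuotientGroup.mk' (Subgroup.zpowers n)))
  obtain ⟨w, hw⟩ := IsIrreducible.exists_ne_zero (ρ := ρ)
  have : Nontrivial W := ⟨⟨w, 0, hw⟩⟩
  obtain ⟨μ, hμ⟩ := Module.End.exists_eigenvalue (ρ n)
  obtain ⟨u, hu, hu0⟩ := hμ.exists_hasEigenvector
  set E := Module.End.eigenspace (ρ n) μ with hE
  have hmaps : ∀ x ∈ E, ρ y x ∈ E := fun x hx => by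
    rw [hE, Module.End.mem_eigenspace_iff] at hx ⊢
    rw [← Module.End.mul_apply, ← (mem_commuteSubgroup.1 hyT).eq, Module.End.mul_apply, hx,
      map_smul]
  have : Nontrivial E := ⟨⟨⟨u, hu⟩, 0, fun h => hu0 (congrArg Subtype.val h)⟩⟩
  obtain ⟨ν, hν⟩ := Module.End.exists_eigenvalue ((ρ y).restrict hmaps)
  obtain ⟨v, hv, hv0⟩ := hν.exists_hasEigenvector
  have hvn : ρ n v = μ • (v : W) := Module.End.mem_eigenspace_iff.1 v.2
  have hvy : ρ y v = ν • (v : W) :=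
    congrArg Subtype.val (Module.End.mem_eigenspace_iff.1 hv)
  refine ⟨v, fun h => hv0 (Subtype.ext h), ?_⟩
  let H : Subgroup G :=
    { carrier := {t | ∃ μ : ℂ, ρ t v = μ • (v : W)}
      mul_mem' := by
        rintro a b ⟨x, hx⟩ ⟨z, hz⟩
        exact ⟨z * x, by rw [map_mul, Module.End.mul_apply, hz, map_smul, hx, smul_smul]⟩
      one_mem' := ⟨1, by simp⟩
      inv_mem' := by
        rintro a ⟨x, hx⟩
        have h1 : (v : W) = x • ρ a⁻¹ v := by
          rw [← map_smul, ← hx, ← Module.End.mul_apply, ← map_mul]; simp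
        have hx0 : x ≠ 0 := by
          rintro rfl
          exact hv0 (Subtype.ext (by simpa using h1))
        refine ⟨x⁻¹, ?_⟩
        conv_rhs => rw [h1]
        rw [smul_smul, inv_mul_cancel₀ hx0, one_smul] }
  intro t ht
  have hyH : y ∈ H := ⟨ν, hvy⟩
  have hnH : Subgroup.zpowers n ≤ H := Subgroup.zpowers_le.2 ⟨μ, hvn⟩
  obtain ⟨k, hk⟩ := Subgroup.mem_zpowers_iff.1 (hy ⟨_, t, ht, rfl⟩)
  have hk' : ((y ^ k : G) : G ⧸ Subgroup.zpowers n) = t := congrArg Subtype.val hk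
  have h1 := hnH (QuotientGroup.eq.1 hk')
  have h2 : t ∈ H := by simpa using H.mul_mem (H.zpow_mem hyH k) h1
  exact h2

/-- The translates of a common eigenvector by coset representatives are eigenvectors of `ρ n` with
distinct eigenvalues, and their span is `G`-stable. -/
theorem finrank_eq_index_commuteSubgroup [FiniteDimensional ℂ W] [ρ.IsIrreducible] (n : G)
    [(Subgroup.zpowers n).Normal] [IsCyclic (G ⧸ Subgroup.zpowers n)] :
    finrank ℂ W = (ρ.commuteSubgroup n).index := by
  have hn : ∀ g : G, g * n * g⁻¹ ∈ Subgroup.zpowers n := fun g =>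
    Subgroup.Normal.conj_mem inferInstance n (Subgroup.mem_zpowers n) g
  obtain ⟨v, hv0, hv⟩ := exists_common_eigenvector (ρ := ρ) n
  set T := ρ.commuteSubgroup n with hT
  have hinv : ∀ (g : G) (w : W), ρ g⁻¹ (ρ g w) = w := fun g w => by
    rw [← Module.End.mul_apply, ← map_mul]; simp
  have hnx : ∀ x : G, x⁻¹ * n * x ∈ Subgroup.zpowers n := fun x => by simpa using hn x⁻¹
  have hev : ∀ x : G ⧸ T, ∃ μ : ℂ, ρ (x.out⁻¹ * n * x.out) v = μ • v := fun x =>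
    hv _ (zpowers_le_commuteSubgroup n (hnx _))
  choose μ hμ using hev
  have hli : LinearIndependent ℂ fun x : G ⧸ T => ρ x.out v := by
    refine Module.End.eigenvectors_linearIndependent' (ρ n) μ ?_ _ fun x =>
      ⟨Module.End.mem_eigenspace_iff.2 ?_, fun h => hv0 ?_⟩
    · intro x y hxy
      have h1 : ρ (x.out⁻¹ * n * x.out) v = ρ (y.out⁻¹ * n * y.out) v := by rw [hμ, hμ, hxy]
      -- Equal eigenvalues give an element of `⟨n⟩` fixing `v`; it acts trivially, so the two
      -- conjugates of `n` act alike and the cosets agree.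
      have h2 : ρ ((y.out⁻¹ * n * y.out)⁻¹ * (x.out⁻¹ * n * x.out)) v = v := by
        rw [map_mul, Module.End.mul_apply, h1, hinv]
      have h3 := IsIrreducible.eq_one_of_fixed hn
        (mul_mem (inv_mem (hnx y.out)) (hnx x.out)) hv0 h2
      have h4 : ρ (x.out⁻¹ * n * x.out) = ρ (y.out⁻¹ * n * y.out) := by
        rw [← mul_one (ρ (y.out⁻¹ * n * y.out)), ← h3, ← map_mul]
        congr 1; group
      have h5 : y.out * x.out⁻¹ ∈ T := by
        change ρ _ * ρ n = ρ n * ρ _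
        have h6 := congrArg (fun f => ρ y.out * f * ρ x.out⁻¹) h4
        simp only [← map_mul] at h6 ⊢
        convert h6 using 2 <;> group
      rw [← x.out_eq', ← y.out_eq', eq_comm]
      have h7 := commuteSubgroup_conj_mem hn (inv_mem h5) y.out⁻¹
      refine QuotientGroup.eq.2 ?_
      convert h7 using 1; group
    · rw [← map_smul, ← hμ, ← Module.End.mul_apply, ← Module.End.mul_apply, ← map_mul, ← map_mul]
      congr 2; group
    · rw [← hinv x.out v, h, map_zero]
  have hspan : Submodule.span ℂ (Set.range fun x : G ⧸ T => ρ x.out v) = ⊤ := by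
    refine IsIrreducible.eq_top_of_mem (ρ := ρ) _ (fun g w hw => ?_)
      (Submodule.subset_span ⟨((1 : G) : G ⧸ T), rfl⟩) (hli.ne_zero _)
    induction hw using Submodule.span_induction with
    | mem _ hx =>
      obtain ⟨x, rfl⟩ := hx
      obtain ⟨t, ht⟩ := QuotientGroup.mk_out_eq_mul T (g * x.out)
      obtain ⟨c, hc⟩ := hv _ (inv_mem t.2)
      have h1 : ρ g (ρ x.out v) = c • ρ (((g * x.out : G) : G ⧸ T)).out v := by
        rw [ht, ← map_smul, ← hc, ← Module.End.mul_apply, ← Module.End.mul_apply, ← map_mul,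
          ← map_mul]
        congr 2; group
      rw [h1]
      exact Submodule.smul_mem _ _ (Submodule.subset_span ⟨_, rfl⟩)
    | zero => simp
    | add x y _ _ hx hy => rw [map_add]; exact add_mem hx hy
    | smul a x _ hx => rw [map_smul]; exact Submodule.smul_mem _ _ hx
  rw [finrank_eq_nat_card_basis (Basis.mk hli hspan.ge)]
  rfl

/-- If `G / ⟨n⟩` is abelian then powers of elements of `commuteSubgroup` are scalar. -/
theorem exists_pow_eq_smul_one [FiniteDimensional ℂ W] [ρ.IsIrreducible] {n : G}
    (hcomm : ∀ g t : G, g * t * g⁻¹ * t⁻¹ ∈ Subgroup.zpowers n) {t : G}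
    (ht : t ∈ ρ.commuteSubgroup n) : ∃ μ : ℂ, ρ t ^ orderOf n = μ • (1 : End ℂ W) := by
  refine IsIrreducible.exists_eq_smul_one (ρ := ρ) _ fun g => ?_
  -- The conjugate of `ρ t` by `ρ g` is `ρ t` times a commuting factor whose `orderOf n`-th power is
  -- `1`, so the power of `ρ t` commutes with every `ρ g`.
  have h1 := commute_of_mem_zpowers (hcomm g t) ht
  obtain ⟨i, hi⟩ := Subgroup.mem_zpowers_iff.1 (hcomm g t)
  have hc : ρ (g * t * g⁻¹ * t⁻¹) ^ orderOf n = 1 := by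
    rw [← map_pow, ← hi, ← zpow_natCast, ← zpow_mul, mul_comm, zpow_mul, zpow_natCast,
      pow_orderOf_eq_one, one_zpow, map_one]
  have h2 : ρ (g * t * g⁻¹) = ρ (g * t * g⁻¹ * t⁻¹) * ρ t := by
    rw [← map_mul]; simp
  have h3 : ρ (g * t * g⁻¹) ^ orderOf n = ρ t ^ orderOf n := by
    rw [h2, h1.symm.mul_pow, hc, one_mul]
  rw [← map_pow, conj_pow] at h3
  rw [← map_pow] at h3 ⊢
  rw [Commute, SemiconjBy]
  conv_lhs => rw [← h3]
  rw [← map_mul, ← map_mul]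
  congr 1; group

/-- Unitarian trick: the averaged form `P` is invariant and positive definite, so the conjugate
transpose of `A g` is similar to `A g⁻¹`. -/
theorem character_inv_eq_conj [Finite G] {d : ℕ} (ρ : Representation ℂ G (Fin d → ℂ)) (g : G) :
    ρ.character g⁻¹ = starRingEnd ℂ (ρ.character g) := by
  classical
  have := Fintype.ofFinite G
  let A : G →* Matrix (Fin d) (Fin d) ℂ :=
    ((LinearMap.toMatrixAlgEquiv' (R := ℂ) (n := Fin d)) : _ →* _).comp ρ
  have htr : ∀ h, ρ.character h = (A h).trace := fun h => by
    rw [character, LinearMap.trace_eq_matrix_trace ℂ (Pi.basisFun ℂ (Fin d))]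
    rfl
  have hone : ∀ h, A h * A h⁻¹ = 1 := fun h => by rw [← map_mul]; simp
  let P : Matrix (Fin d) (Fin d) ℂ := ∑ h : G, (A h).conjTranspose * A h
  have hP : P.PosDef := by
    rw [show P = _ from (Finset.add_sum_erase _ _ (Finset.mem_univ (1 : G))).symm]
    refine Matrix.PosDef.add_posSemidef ?_ (Matrix.posSemidef_sum _ fun h _ =>
      Matrix.posSemidef_conjTranspose_mul_self _)
    simpa using Matrix.PosDef.one
  have hu : IsUnit P.det := hP.isUnit.map Matrix.detMonoidHom
  have hinv : (A g).conjTranspose * P = P * A g⁻¹ := by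
    have h1 : (A g).conjTranspose * P * A g = P := by
      simp only [P, Finset.mul_sum, Finset.sum_mul]
      refine Fintype.sum_equiv (Equiv.mulRight g) _ _ fun h => ?_
      simp [Matrix.conjTranspose_mul, Matrix.mul_assoc]
    rw [← h1]
    simp only [Matrix.mul_assoc, hone, Matrix.mul_one]
    simp only [← Matrix.mul_assoc, h1]
  have h2 : A g⁻¹ = P⁻¹ * ((A g).conjTranspose * P) := by
    rw [hinv, ← Matrix.mul_assoc, Matrix.nonsing_inv_mul _ hu, Matrix.one_mul]
  rw [htr, htr, h2, Matrix.trace_mul_comm, Matrix.mul_assoc, Matrix.mul_nonsing_inv _ hu,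
    Matrix.mul_one, Matrix.trace_conjTranspose]
  rfl

/-- The sum of `χ t • ρ t⁻¹` is central, so Schur's lemma supplies `κ`. At `z = 1` the left side is
the sum of `|χ t|²`, which is positive; only `κ ≠ 0` matters later. -/
theorem exists_sum_character_mul_conj [Fintype G] {d : ℕ} (ρ : Representation ℂ G (Fin d → ℂ))
    [ρ.IsIrreducible] : ∃ κ : ℂ, κ ≠ 0 ∧
      ∀ z : G, ∑ t : G, ρ.character (z * t⁻¹) * ρ.character t = κ * ρ.character z := by
  obtain ⟨κ, hκ⟩ := IsIrreducible.exists_eq_smul_one (ρ := ρ)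
    (∑ t : G, ρ.character t • ρ t⁻¹) (fun g => by
      rw [Commute, SemiconjBy, Finset.sum_mul, Finset.mul_sum]
      refine Fintype.sum_equiv (MulAut.conj g⁻¹).toEquiv _ _ fun t => ?_
      simp only [MulEquiv.toEquiv_eq_coe, MulEquiv.coe_toEquiv, MulAut.conj_apply, char_conj,
        smul_mul_assoc, mul_smul_comm, ← map_mul]
      congr 2; group)
  have key : ∀ z : G, ∑ t : G, ρ.character (z * t⁻¹) * ρ.character t = κ * ρ.character z := by
    intro z
    have h1 := congrArg (fun f => LinearMap.trace ℂ _ (ρ z * f)) hκ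
    simp only [Finset.mul_sum, mul_smul_comm, map_sum, map_smul, ← map_mul, mul_one,
      smul_eq_mul] at h1
    rw [character, ← h1]
    exact Finset.sum_congr rfl fun t _ => mul_comm _ _
  refine ⟨κ, ?_, key⟩
  rintro rfl
  have h1 := key 1
  simp only [one_mul, zero_mul, character_inv_eq_conj, ← Complex.normSq_eq_conj_mul_self] at h1
  rw [← Complex.ofReal_sum, Complex.ofReal_eq_zero,
    Finset.sum_eq_zero_iff_of_nonneg fun _ _ => Complex.normSq_nonneg _] at h1
  have h2 := h1 1 (Finset.mem_univ _)
  rw [char_one, Complex.normSq_eq_zero, Nat.cast_eq_zero] at h2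
  obtain ⟨v, hv⟩ := IsIrreducible.exists_ne_zero (ρ := ρ)
  have : Subsingleton (Fin d → ℂ) := Module.finrank_zero_iff.1 h2
  exact hv (Subsingleton.elim _ _)

end Representation

/-! ### Traces and sums of roots of unity -/

open Module

/-- Dividing `f` by an `s`-th root of `c` turns its eigenvalues into `s`-th roots of unity. -/
theorem Module.End.exists_trace_eq_mul_sum {W : Type*} [AddCommGroup W] [Module ℂ W]
    [FiniteDimensional ℂ W] {f : End ℂ W} {s : ℕ} (hs : s ≠ 0) {c : ℂ} (hc : c ≠ 0)
    (hf : f ^ s = c • (1 : End ℂ W)) :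
    ∃ (a : ℂ) (m : Multiset ℂ), a ≠ 0 ∧ m.card = finrank ℂ W ∧ (∀ z ∈ m, z ^ s = 1) ∧
      LinearMap.trace ℂ W f = a * m.sum := by
  obtain ⟨a, ha⟩ := IsAlgClosed.exists_pow_nat_eq c (Nat.pos_of_ne_zero hs)
  have ha0 : a ≠ 0 := by
    rintro rfl
    exact hc (by rw [← ha, zero_pow hs])
  have hsplit : f.charpoly.Splits := IsAlgClosed.splits _
  refine ⟨a, f.charpoly.roots.map (a⁻¹ * ·), ha0, ?_, ?_, ?_⟩
  · rw [Multiset.card_map, Polynomial.splits_iff_card_roots.1 hsplit, LinearMap.charpoly_natDegree]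
  · intro z hz
    obtain ⟨r, hr, rfl⟩ := Multiset.mem_map.1 hz
    have hev := (Module.End.hasEigenvalue_iff_isRoot_charpoly f r).2
      (Polynomial.isRoot_of_mem_roots hr)
    obtain ⟨v, hv⟩ := hev.exists_hasEigenvector
    have h1 := hv.pow_apply s
    rw [hf, LinearMap.smul_apply, Module.End.one_apply] at h1
    have h2 : c = r ^ s := smul_left_injective ℂ hv.2 h1
    rw [mul_pow, ← h2, inv_pow, ha, inv_mul_cancel₀ hc]
  · rw [Module.End.trace_eq_sum_roots_charpoly_of_splits hsplit, Multiset.sum_map_mul_left,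
      Multiset.map_id', ← mul_assoc, mul_inv_cancel₀ ha0, one_mul]

theorem Multiset.exists_sum_pow_prime_pow_eq {R : Type*} [CommRing R] {p : ℕ} (hp : p.Prime)
    (a : ℕ) (m : Multiset R) : ∃ r, m.sum ^ p ^ a = (m.map (· ^ p ^ a)).sum + p * r := by
  induction m using Multiset.induction with
  | empty => exact ⟨0, by simp [hp.ne_zero]⟩
  | cons x m ih =>
    obtain ⟨r, hr⟩ := ih
    obtain ⟨u, hu⟩ := exists_add_pow_prime_pow_eq hp x m.sum a
    exact ⟨r + x * m.sum * u, by
      rw [Multiset.sum_cons, hu, hr, Multiset.map_cons, Multiset.sum_cons]; ring⟩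

/-- Modulo `p`, the `p ^ a`-th power of the sum is the cardinality. If the sum were zero, `card / p`
would be a rational algebraic integer, hence an integer. -/
theorem Multiset.sum_ne_zero_of_prime_pow {p a : ℕ} (hp : p.Prime) {m : Multiset ℂ}
    (hm : ∀ z ∈ m, z ^ p ^ a = 1) (hcard : ¬ p ∣ m.card) : m.sum ≠ 0 := by
  intro h0
  have hint : ∀ z ∈ m, z ∈ integralClosure ℤ ℂ := fun z hz =>
    IsIntegral.of_pow (pow_pos hp.pos a) (by rw [hm z hz]; exact isIntegral_one)
  obtain ⟨m', rfl⟩ : ∃ m' : Multiset (integralClosure ℤ ℂ), m'.map Subtype.val = m :=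
    ⟨m.pmap Subtype.mk hint, by simp [Multiset.map_pmap, Multiset.pmap_eq_map]⟩
  obtain ⟨r, hr⟩ := Multiset.exists_sum_pow_prime_pow_eq hp a m'
  have h1 : m'.sum = 0 := by
    apply Subtype.ext
    exact (map_multiset_sum (integralClosure ℤ ℂ).subtype m').trans h0
  have h2 : m'.map (· ^ p ^ a) = m'.map fun _ => 1 := Multiset.map_congr rfl fun x hx =>
    Subtype.ext (by simpa using hm x (Multiset.mem_map_of_mem _ hx))
  rw [h1, h2, zero_pow (pow_pos hp.pos a).ne', Multiset.map_const', Multiset.sum_replicate,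
    nsmul_one] at hr
  have h3 : (m'.card : ℂ) + p * (r : ℂ) = 0 := by
    have := congrArg (fun x : integralClosure ℤ ℂ => (x : ℂ)) hr
    simpa using this.symm
  have hp0 : (p : ℂ) ≠ 0 := Nat.cast_ne_zero.2 hp.ne_zero
  have h4 : (r : ℂ) = algebraMap ℚ ℂ (-(m'.card : ℚ) / p) := by
    simp only [map_div₀, map_neg, map_natCast]
    field_simp
    linear_combination h3
  have h5 : IsIntegral ℤ (-(m'.card : ℚ) / p) := by
    have := r.2
    rw [h4] at this
    exact (isIntegral_algebraMap_iff (algebraMap ℚ ℂ).injective).1 this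
  obtain ⟨k, hk⟩ := IsIntegrallyClosed.isIntegral_iff.1 h5
  apply hcard
  have hpq : (p : ℚ) ≠ 0 := Nat.cast_ne_zero.2 hp.ne_zero
  have h6 : (m'.card : ℤ) = p * -k := by
    have : (k : ℚ) = -(m'.card : ℚ) / p := by simpa using hk
    field_simp at this
    have h7 : ((m'.card : ℤ) : ℚ) = ((p * -k : ℤ) : ℚ) := by push_cast; linarith
    exact_mod_cast h7
  rw [Multiset.card_map]
  exact Int.natCast_dvd_natCast.1 ⟨_, h6⟩

theorem Multiset.sum_ne_zero_of_card_le_two {s : ℕ} (hs : Odd s) {m : Multiset ℂ}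
    (hm : ∀ z ∈ m, z ^ s = 1) (h0 : m ≠ 0) (hcard : m.card ≤ 2) : m.sum ≠ 0 := by
  have hne : ∀ z ∈ m, z ≠ 0 := by
    rintro z hz rfl
    have := hm 0 hz
    rw [zero_pow (by rintro rfl; simp at hs)] at this
    exact zero_ne_one this
  have h1 : m.card = 1 ∨ m.card = 2 := by
    have := Multiset.card_pos.2 h0
    omega
  rcases h1 with h | h
  · obtain ⟨a, rfl⟩ := Multiset.card_eq_one.1 h
    simpa using hne a (by simp)
  · obtain ⟨a, b, rfl⟩ := Multiset.card_eq_two.1 h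
    intro h2
    have h3 : a = -b := by
      simp at h2
      linear_combination h2
    have ha := hm a (by simp)
    have hb := hm b (by simp)
    rw [h3, hs.neg_pow, hb] at ha
    norm_num at ha

namespace Representation

variable {G W : Type*} [Group G] [AddCommGroup W] [Module ℂ W] {ρ : Representation ℂ G W}

/-- `hsum` abstracts the two arithmetic facts on sums of roots of unity, so that one argument serves
all cases. -/
theorem character_ne_zero_of_mem_commuteSubgroup [Finite G] [FiniteDimensional ℂ W]
    [ρ.IsIrreducible] {n : G}
    (hcomm : ∀ g t : G, g * t * g⁻¹ * t⁻¹ ∈ Subgroup.zpowers n)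
    (hsum : ∀ m : Multiset ℂ, m.card = finrank ℂ W → (∀ z ∈ m, z ^ orderOf n = 1) → m.sum ≠ 0)
    {t : G} (ht : t ∈ ρ.commuteSubgroup n) : ρ.character t ≠ 0 := by
  obtain ⟨c, hc⟩ := exists_pow_eq_smul_one hcomm ht
  have hc0 : c ≠ 0 := by
    rintro rfl
    obtain ⟨v, hv⟩ := IsIrreducible.exists_ne_zero (ρ := ρ)
    rw [zero_smul, ← map_pow] at hc
    refine hv ?_
    have : ρ ((t ^ orderOf n)⁻¹ * t ^ orderOf n) v = v := by simp
    rw [← this, map_mul, hc]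
    simp
  obtain ⟨a, m, ha, hm, hz, htr⟩ := Module.End.exists_trace_eq_mul_sum (orderOf_pos n).ne' hc0 hc
  rw [character, htr]
  exact mul_ne_zero ha (hsum m hm hz)

/-- An element of finite order whose powers have proportional traces acts as a scalar. -/
theorem exists_eq_smul_one_of_character_mul [Finite G] [FiniteDimensional ℂ W]
    [Nontrivial W] {n : G} {μ : ℂ}
    (h : ∀ j : ℕ, ρ.character (n ^ (j + 1)) = μ * ρ.character (n ^ j)) : ρ n = μ • 1 := by
  have h1 : ∀ j : ℕ, ρ.character (n ^ j) = μ ^ j * finrank ℂ W := by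
    intro j
    induction j with
    | zero => simp
    | succ j ih => rw [h, ih, pow_succ']; ring
  have hd : (finrank ℂ W : ℂ) ≠ 0 := Nat.cast_ne_zero.2 finrank_pos.ne'
  set M := orderOf n with hM
  have hM0 : (M : ℂ) ≠ 0 := Nat.cast_ne_zero.2 (orderOf_pos n).ne'
  have hμM : μ ^ M = 1 := by
    have h2 := h1 M
    rw [pow_orderOf_eq_one, char_one] at h2
    exact (mul_right_cancel₀ hd (by rw [← h2, one_mul])).symm
  have hμ0 : μ ≠ 0 := by
    rintro rfl
    rw [zero_pow (orderOf_pos n).ne'] at hμM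
    exact zero_ne_one hμM
  -- All powers of `B` have trace `finrank ℂ W`, so the projection `P` onto its fixed vectors has
  -- full rank and `B = 1`.
  set B : End ℂ W := μ⁻¹ • ρ n with hB
  have hBM : B ^ M = 1 := by
    rw [hB, smul_pow, ← map_pow, pow_orderOf_eq_one, inv_pow, hμM, inv_one, one_smul, map_one]
  have htrB : ∀ j, LinearMap.trace ℂ W (B ^ j) = finrank ℂ W := by
    intro j
    rw [hB, smul_pow, ← map_pow, map_smul]
    change _ • ρ.character (n ^ j) = _
    rw [h1, smul_eq_mul, ← mul_assoc, inv_pow, inv_mul_cancel₀ (pow_ne_zero _ hμ0), one_mul]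
  set P : End ℂ W := (M : ℂ)⁻¹ • ∑ j ∈ Finset.range M, B ^ j with hP
  have hBP : B * P = P := by
    rw [hP, mul_smul_comm, Finset.mul_sum]
    simp only [← pow_succ']
    congr 1
    have h2 := Finset.sum_range_succ (fun j => B ^ j) M
    rw [Finset.sum_range_succ', hBM, pow_zero] at h2
    exact add_right_cancel h2
  have hBjP : ∀ j : ℕ, B ^ j * P = P := by
    intro j
    induction j with
    | zero => simp
    | succ j ih => rw [pow_succ, mul_assoc, hBP, ih]
  have hPP : IsIdempotentElem P := by
    change P * P = P
    conv_lhs => rw [hP]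
    rw [smul_mul_assoc, ← hP, Finset.sum_mul, Finset.sum_congr rfl fun j _ => hBjP j]
    rw [Finset.sum_const, Finset.card_range, ← Nat.cast_smul_eq_nsmul ℂ, smul_smul,
      inv_mul_cancel₀ hM0, one_smul]
  have htrP : LinearMap.trace ℂ W P = finrank ℂ W := by
    rw [hP, map_smul, map_sum, Finset.sum_congr rfl fun j _ => htrB j]
    rw [Finset.sum_const, Finset.card_range, nsmul_eq_mul, smul_eq_mul, ← mul_assoc,
      inv_mul_cancel₀ hM0, one_mul]
  have hproj : LinearMap.IsProj (LinearMap.range P) P :=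
    LinearMap.IsIdempotentElem.isProj_range P hPP
  rw [hproj.trace, Nat.cast_inj] at htrP
  have hPtop := Submodule.eq_top_of_finrank_eq htrP
  have hP1 : P = 1 := LinearMap.ext fun w =>
    hproj.map_id w (hPtop ▸ Submodule.mem_top)
  rw [hP1, mul_one, hB] at hBP
  rw [← hBP, smul_smul, mul_inv_cancel₀ hμ0, one_smul]

end Representation

/-! ### Inner products of symmetrized tensors and o*-bases -/

noncomputable section

namespace SymTensor

variable {V : Type*} [NormedAddCommGroup V] [InnerProductSpace ℂ V] {n m : ℕ}

/-- `tensorInner` as a sesquilinear map. -/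
def tensorInnerₛₗ (b : OrthonormalBasis (Fin n) ℂ V) :
    TensorPower V m →ₗ⋆[ℂ] TensorPower V m →ₗ[ℂ] ℂ :=
  LinearMap.mk₂'ₛₗ (starRingEnd ℂ) (RingHom.id ℂ) (tensorInner b)
    (fun x y z => by simp [tensorInner, add_mul, Finset.sum_add_distrib])
    (fun c x y => by simp [tensorInner, Finset.mul_sum, mul_assoc])
    (fun x y z => by simp [tensorInner, mul_add, Finset.sum_add_distrib])
    (fun c x y => by simp [tensorInner, Finset.mul_sum, mul_left_comm])

theorem tensorInnerₛₗ_apply (b : OrthonormalBasis (Fin n) ℂ V) (x y : TensorPower V m) :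
    tensorInnerₛₗ b x y = tensorInner b x y := rfl

theorem eq_zero_of_tensorInner_self (b : OrthonormalBasis (Fin n) ℂ V) {x : TensorPower V m}
    (h : tensorInner b x x = 0) : x = 0 := by
  simp only [tensorInner, ← Complex.normSq_eq_conj_mul_self] at h
  rw [← Complex.ofReal_sum, Complex.ofReal_eq_zero,
    Finset.sum_eq_zero_iff_of_nonneg fun _ _ => Complex.normSq_nonneg _] at h
  apply (Basis.piTensorProduct fun _ : Fin m => b.toBasis).repr.injective
  ext α
  simpa using h α (Finset.mem_univ _)

theorem tensorInner_basis (b : OrthonormalBasis (Fin n) ℂ V) (α β : Fin m → Fin n) :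
    tensorInner b (PiTensorProduct.tprod ℂ fun i => b (α i))
      (PiTensorProduct.tprod ℂ fun i => b (β i)) = if α = β then 1 else 0 := by
  rw [tensorInner_tprod]
  simp only [OrthonormalBasis.inner_eq_ite]
  split_ifs with h
  · simp [h]
  · obtain ⟨i, hi⟩ := Function.ne_iff.1 h
    exact Finset.prod_eq_zero (Finset.mem_univ i) (if_neg hi)

/-- The action `ασ = (α_{σ⁻¹(1)}, …, α_{σ⁻¹(m)})` on index sequences. -/
def permAct (σ : Equiv.Perm (Fin m)) (α : Fin m → Fin n) : Fin m → Fin n := fun i => α (σ⁻¹ i)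

@[simp]
theorem permAct_one (α : Fin m → Fin n) : permAct 1 α = α := rfl

theorem permAct_mul (σ τ : Equiv.Perm (Fin m)) (α : Fin m → Fin n) :
    permAct (σ * τ) α = permAct σ (permAct τ α) := by
  funext i
  simp [permAct]

theorem permAct_inv_permAct (σ : Equiv.Perm (Fin m)) (α : Fin m → Fin n) :
    permAct σ⁻¹ (permAct σ α) = α := by
  rw [← permAct_mul, inv_mul_cancel, permAct_one]

theorem permAct_injective (σ : Equiv.Perm (Fin m)) :
    Function.Injective (permAct σ : (Fin m → Fin n) → _) := fun α β h => by
  rw [← permAct_inv_permAct σ α, h, permAct_inv_permAct]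

variable {G : Subgroup (Equiv.Perm (Fin m))} {χ : G → ℂ}

theorem starTensor_eq_sum [Fintype G] (b : OrthonormalBasis (Fin n) ℂ V) (α : Fin m → Fin n) :
    starTensor b G χ α = (χ 1 / (Nat.card G : ℂ)) •
      ∑ σ : G, χ σ • PiTensorProduct.tprod ℂ fun i => b (permAct σ α i) := by
  simp only [starTensor, symmetrizer, LinearMap.smul_apply, LinearMap.sum_apply, permOp_tprod,
    permAct]
  congr!

theorem tensorInner_starTensor [Fintype G] (b : OrthonormalBasis (Fin n) ℂ V)
    (α β : Fin m → Fin n) : tensorInner b (starTensor b G χ α) (starTensor b G χ β) =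
      starRingEnd ℂ (χ 1 / (Nat.card G : ℂ)) * (χ 1 / (Nat.card G : ℂ)) *
      ∑ τ : G, ∑ σ : G, if permAct σ α = permAct τ β then starRingEnd ℂ (χ σ) * χ τ else 0 := by
  rw [← tensorInnerₛₗ_apply, starTensor_eq_sum, starTensor_eq_sum]
  simp only [map_smul, map_sum, LinearMap.map_smulₛₗ, LinearMap.smul_apply, LinearMap.sum_apply,
    tensorInnerₛₗ_apply, tensorInner_basis, smul_eq_mul, Finset.mul_sum]
  refine Finset.sum_congr rfl fun τ _ => ?_
  refine Finset.sum_congr rfl fun σ _ => ?_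
  split_ifs <;> ring

theorem tensorInner_starTensor_of_forall_ne (b : OrthonormalBasis (Fin n) ℂ V)
    {α β : Fin m → Fin n} (h : ∀ g : G, β ≠ permAct g α) :
    tensorInner b (starTensor b G χ α) (starTensor b G χ β) = 0 := by
  have := Fintype.ofFinite G
  rw [tensorInner_starTensor, Finset.sum_eq_zero, mul_zero]
  refine fun τ _ => Finset.sum_eq_zero fun σ _ => if_neg fun hστ => h (τ⁻¹ * σ) ?_
  rw [Subgroup.coe_mul, Subgroup.coe_inv, permAct_mul, hστ, permAct_inv_permAct]

/-- The contributing pairs are `σ = τ * y * h * x⁻¹` with `h` fixing `β`. For fixed `h` the sum over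
`τ` is a convolution of the character with itself, which only rescales it. -/
theorem tensorInner_starTensor_permAct [Fintype G] {d : ℕ} (ρ : Representation ℂ G (Fin d → ℂ))
    [ρ.IsIrreducible] (b : OrthonormalBasis (Fin n) ℂ V) : ∃ C : ℂ, C ≠ 0 ∧
      ∀ (β : Fin m → Fin n) (x y : G),
      tensorInner b (starTensor b G ρ.character (permAct x β))
        (starTensor b G ρ.character (permAct y β)) =
      C * ∑ h : G, if permAct h β = β then ρ.character (x * h * y⁻¹) else 0 := by
  obtain ⟨κ, hκ, hsum⟩ := ρ.exists_sum_character_mul_conj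
  have h1 : ρ.character 1 / (Nat.card G : ℂ) ≠ 0 := by
    obtain ⟨v, hv⟩ := Representation.IsIrreducible.exists_ne_zero (ρ := ρ)
    have : Nontrivial (Fin d → ℂ) := ⟨⟨v, 0, hv⟩⟩
    rw [Representation.char_one]
    exact div_ne_zero (Nat.cast_ne_zero.2 Module.finrank_pos.ne')
      (Nat.cast_ne_zero.2 Nat.card_pos.ne')
  refine ⟨_, mul_ne_zero (mul_ne_zero ((map_ne_zero (starRingEnd ℂ)).2 h1) h1) hκ,
    fun β x y => ?_⟩
  rw [tensorInner_starTensor, mul_assoc _ κ]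
  congr 1
  calc _ = ∑ τ : G, ∑ h : G, if permAct h β = β then
          ρ.character (x * h⁻¹ * y⁻¹ * τ⁻¹) * ρ.character τ else 0 := by
        refine Finset.sum_congr rfl fun τ _ => ?_
        refine (Fintype.sum_equiv ((Equiv.mulLeft (τ * y)).trans (Equiv.mulRight x⁻¹)) _ _
          fun h => ?_).symm
        have h2 : permAct ((((Equiv.mulLeft (τ * y)).trans (Equiv.mulRight x⁻¹)) h : G) :
            Equiv.Perm (Fin m)) (permAct x β) = permAct τ (permAct y β) ↔ permAct h β = β := by
          rw [← permAct_mul, ← permAct_mul]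
          have : ((((Equiv.mulLeft (τ * y)).trans (Equiv.mulRight x⁻¹)) h : G) :
            Equiv.Perm (Fin m)) * x = ↑(τ * y) * h := by simp [mul_assoc]
          rw [this, permAct_mul, ← Subgroup.coe_mul]
          exact (permAct_injective _).eq_iff
        simp only [h2]
        congr 2
        rw [← Representation.character_inv_eq_conj]
        simp [mul_assoc]
    _ = ∑ h : G, if permAct h β = β then κ * ρ.character (x * h⁻¹ * y⁻¹) else 0 := by
        rw [Finset.sum_comm]
        refine Finset.sum_congr rfl fun h _ => ?_
        split_ifs
        · exact hsum _
        · simp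
    _ = _ := by
        rw [Finset.mul_sum]
        refine Fintype.sum_equiv (Equiv.inv G) _ _ fun h => ?_
        have h2 : permAct (((Equiv.inv G) h : G) : Equiv.Perm (Fin m)) β = β ↔
            permAct h β = β := by
          constructor
          · intro h3
            conv_lhs => rw [← h3]
            rw [← permAct_mul]; simp
          · intro h3
            conv_lhs => rw [← h3]
            rw [← permAct_mul]; simp
        simp only [h2]
        split_ifs <;> simp

theorem symmetryClass_eq_span (b : OrthonormalBasis (Fin n) ℂ V) :
    symmetryClass V G χ = Submodule.span ℂ (Set.range (starTensor b G χ)) := by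
  rw [symmetryClass, LinearMap.range_eq_map,
    ← (Basis.piTensorProduct fun _ : Fin m => b.toBasis).span_eq, Submodule.map_span,
    ← Set.range_comp]
  congr 2
  funext α
  simp [starTensor, Basis.piTensorProduct_apply]

/-- If `χ` vanishes precisely off a normal subgroup `T` that meets some `G_α` trivially, then in
the presence of an o*-basis translation by an element of `T` multiplies `χ` by a constant on `T`. -/
theorem HasOStarBasis.exists_character_mul {d : ℕ} {ρ : Representation ℂ G (Fin d → ℂ)}
    [ρ.IsIrreducible] {b : OrthonormalBasis (Fin n) ℂ V} {T : Subgroup G} [hT : T.Normal]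
    (hzero : ∀ g, ρ.character g = 0 ↔ g ∉ T) {α : Fin m → Fin n}
    (hα : ∀ h ∈ T, permAct h α = α → h = 1) (hS : HasOStarBasis b G ρ.character) :
    ∀ t ∈ T, ∃ μ : ℂ, ∀ x ∈ T, ρ.character (x * t) = μ * ρ.character x := by
  have := Fintype.ofFinite G
  obtain ⟨C, hC, hinner⟩ := tensorInner_starTensor_permAct ρ b
  obtain ⟨S, -, hspan, horth⟩ := hS
  -- The members of `S` span the symmetry class, so orthogonality to them is orthogonality to every
  -- `e*_γ`.
  have hext : ∀ w : TensorPower V m,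
      (∀ γ ∈ S, tensorInner b (starTensor b G ρ.character γ) w = 0) →
      ∀ γ, tensorInner b (starTensor b G ρ.character γ) w = 0 := by
    intro w hw γ
    have hγ : starTensor b G ρ.character γ ∈
        Submodule.span ℂ (starTensor b G ρ.character '' S) := by
      rw [hspan]
      exact ⟨_, rfl⟩
    have hle : Submodule.span ℂ (starTensor b G ρ.character '' S) ≤
        LinearMap.ker ((tensorInnerₛₗ b).flip w) := by
      rw [Submodule.span_le]
      rintro _ ⟨δ, hδ, rfl⟩
      exact hw δ hδ
    exact hle hγ
  -- Two elements `h` of the stabilizer with `x * h * y⁻¹ ∈ T` differ by an element of `T` fixing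
  -- `β`, as `T` is normal; so at most one term is nonzero.
  have hsum1 : ∀ β : Fin m → Fin n, (∀ h ∈ T, permAct h β = β → h = 1) → ∀ x y h₀ : G,
      permAct h₀ β = β → x * h₀ * y⁻¹ ∈ T →
      (∑ h : G, if permAct h β = β then ρ.character (x * h * y⁻¹) else 0) =
        ρ.character (x * h₀ * y⁻¹) := by
    intro β hβ x y h₀ hh₀ hmem
    rw [Finset.sum_eq_single h₀ _ (by simp), if_pos hh₀]
    intro h _ hne
    split_ifs with hh
    · rw [hzero]
      intro hh2
      apply hne
      have h1 : x⁻¹ * (x * h * y⁻¹ * (x * h₀ * y⁻¹)⁻¹) * x⁻¹⁻¹ ∈ T :=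
        hT.conj_mem _ (mul_mem hh2 (inv_mem hmem)) x⁻¹
      have h2 : x⁻¹ * (x * h * y⁻¹ * (x * h₀ * y⁻¹)⁻¹) * x⁻¹⁻¹ = h * h₀⁻¹ := by group
      rw [h2] at h1
      refine mul_inv_eq_one.1 (hβ _ h1 ?_)
      rw [Subgroup.coe_mul, permAct_mul, Subgroup.coe_inv]
      conv_lhs => rw [← hh₀]
      rw [permAct_inv_permAct, hh]
    · rfl
  have hsum0 : ∀ (β : Fin m → Fin n) (x y : G),
      (∀ h : G, permAct h β = β → x * h * y⁻¹ ∉ T) →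
      (∑ h : G, if permAct h β = β then ρ.character (x * h * y⁻¹) else 0) = 0 := by
    intro β x y hxy
    refine Finset.sum_eq_zero fun h _ => ?_
    split_ifs with hh
    · exact (hzero _).2 (hxy h hh)
    · rfl
  have hself : ∀ β : Fin m → Fin n, (∀ h ∈ T, permAct h β = β → h = 1) →
      tensorInner b (starTensor b G ρ.character β) (starTensor b G ρ.character β) ≠ 0 := by
    intro β hβ
    have h1 := hinner β 1 1
    rw [hsum1 β hβ 1 1 1 rfl (by simp)] at h1
    simp only [Subgroup.coe_one, permAct_one] at h1
    rw [h1]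
    refine mul_ne_zero hC fun h => (hzero _).1 h (by simp)
  -- Trivial intersection with `T` is constant on orbits. Without such a `β`, `S` would miss the
  -- orbit of `α` and `e*_α` would be orthogonal to itself.
  obtain ⟨β, hβS, hβ⟩ : ∃ β ∈ S, ∀ h ∈ T, permAct h β = β → h = 1 := by
    by_contra! hcon
    refine hself α hα (hext _ (fun γ hγ => ?_) α)
    refine tensorInner_starTensor_of_forall_ne b fun g hg => ?_
    obtain ⟨h, hhT, hh, hh1⟩ := hcon γ hγ
    apply hh1
    have h2 := hα _ (hT.conj_mem h hhT g) (by
      rw [Subgroup.coe_mul, Subgroup.coe_mul, permAct_mul, permAct_mul, hg, Subgroup.coe_inv,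
        permAct_inv_permAct, hh])
    simpa using h2
  intro t ht
  set Φ := fun x y : G => tensorInner b (starTensor b G ρ.character (permAct x β))
    (starTensor b G ρ.character (permAct y β)) with hΦ
  have hΦ11 : Φ 1 1 ≠ 0 := hself β hβ
  -- Subtract from the translate of `e*_β` by `t⁻¹` its projection onto `e*_β`; the remainder is
  -- orthogonal to all of `S`.
  have hkey : ∀ x : G, tensorInner b (starTensor b G ρ.character (permAct x β))
      (starTensor b G ρ.character (permAct (t⁻¹ : G) β) -
        (Φ 1 t⁻¹ / Φ 1 1) • starTensor b G ρ.character β) = 0 := by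
    intro x
    refine hext _ (fun γ hγ => ?_) _
    rw [← tensorInnerₛₗ_apply, map_sub, map_smul, tensorInnerₛₗ_apply, tensorInnerₛₗ_apply]
    rcases eq_or_ne γ β with rfl | hne
    · change Φ 1 t⁻¹ - (Φ 1 t⁻¹ / Φ 1 1) * Φ 1 1 = 0
      rw [div_mul_cancel₀ _ hΦ11, sub_self]
    · rw [horth hγ hβS hne, smul_zero, sub_zero]
      by_cases hex : ∃ x : G, γ = permAct x β
      · obtain ⟨x, rfl⟩ := hex
        rw [hinner, hsum0, mul_zero]
        -- Since `t ∈ T`, a nonzero term here would put `x * h` in `T`, making `e*_γ` and `e*_β`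
        -- non-orthogonal.
        intro h hh hmem
        have h0 := horth hγ hβS hne
        have h1 := hinner β x 1
        have hxh : x * h * 1⁻¹ ∈ T := by simpa using mul_mem hmem (inv_mem ht)
        rw [hsum1 β hβ x 1 h hh hxh] at h1
        simp only [Subgroup.coe_one, permAct_one] at h1
        rw [h0, eq_comm, mul_eq_zero, hzero] at h1
        exact h1.elim hC fun h2 => h2 hxh
      · refine tensorInner_starTensor_of_forall_ne b fun g hg => hex ⟨g⁻¹ * t⁻¹, ?_⟩
        rw [Subgroup.coe_mul, permAct_mul, hg, Subgroup.coe_inv, permAct_inv_permAct]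
  refine ⟨Φ 1 t⁻¹ / Φ 1 1, fun x hx => ?_⟩
  have h1 := hkey x
  rw [← tensorInnerₛₗ_apply, map_sub, map_smul, tensorInnerₛₗ_apply, tensorInnerₛₗ_apply,
    hinner, hsum1 β hβ x t⁻¹ 1 rfl (by simpa using mul_mem hx ht)] at h1
  have h2 := hinner β x 1
  rw [hsum1 β hβ x 1 1 rfl (by simpa using hx)] at h2
  simp only [Subgroup.coe_one, permAct_one] at h2
  rw [h2, smul_eq_mul, mul_left_comm, ← mul_sub, mul_eq_zero] at h1
  simpa [sub_eq_zero] using h1.resolve_left hC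

/-- Moving `α` within its orbit only multiplies `e*_α` by a value of `χ`, and distinct orbits are
orthogonal: take one representative of each orbit whose tensor is nonzero. -/
theorem hasOStarBasis_of_map_mul (b : OrthonormalBasis (Fin n) ℂ V)
    (hmul : ∀ g h : G, χ (g * h) = χ g * χ h) (hone : χ 1 = 1) : HasOStarBasis b G χ := by
  have := Fintype.ofFinite G
  have hact : ∀ (g : G) (α : Fin m → Fin n),
      starTensor b G χ (permAct g α) = χ g⁻¹ • starTensor b G χ α := by
    intro g α
    rw [starTensor_eq_sum, starTensor_eq_sum, smul_comm (χ g⁻¹)]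
    refine congrArg ((χ 1 / (Nat.card G : ℂ)) • ·) ?_
    rw [Finset.smul_sum]
    refine Fintype.sum_equiv (Equiv.mulRight g) _ _ fun σ => ?_
    rw [smul_smul, ← hmul, ← permAct_mul, ← Subgroup.coe_mul]
    have hcomm : χ (g⁻¹ * (Equiv.mulRight g) σ) = χ σ := by
      rw [Equiv.coe_mulRight, hmul, hmul, mul_comm, mul_assoc, ← hmul, mul_inv_cancel, hone,
        mul_one]
    rw [hcomm]
    rfl
  let r : Setoid (Fin m → Fin n) :=
    { r := fun α β => ∃ g : G, β = permAct g α
      iseqv := ⟨fun α => ⟨1, rfl⟩, by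
        rintro α _ ⟨g, rfl⟩
        exact ⟨g⁻¹, (permAct_inv_permAct _ _).symm⟩, by
        rintro α _ _ ⟨g, rfl⟩ ⟨h, rfl⟩
        exact ⟨h * g, (permAct_mul _ _ _).symm⟩⟩ }
  let S : Set (Fin m → Fin n) := {α | starTensor b G χ α ≠ 0 ∧ (Quotient.mk r α).out = α}
  have horth : S.Pairwise fun α β =>
      tensorInner b (starTensor b G χ α) (starTensor b G χ β) = 0 := by
    rintro α ⟨-, hα⟩ β ⟨-, hβ⟩ hne
    refine tensorInner_starTensor_of_forall_ne b fun g hg => hne ?_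
    rw [← hα, ← hβ]
    exact congrArg Quotient.out (Quotient.sound (s := r) ⟨g, hg⟩)
  refine ⟨S, ?_, ?_, horth⟩
  · rw [LinearIndepOn, linearIndependent_iff']
    intro s c hc α hα
    have h1 := congrArg (tensorInnerₛₗ b (starTensor b G χ α)) hc
    rw [map_sum, map_zero, Finset.sum_eq_single α] at h1
    · rw [map_smul, smul_eq_mul, mul_eq_zero] at h1
      exact h1.resolve_right fun h => α.2.1 (eq_zero_of_tensorInner_self b h)
    · intro β _ hβ
      rw [map_smul, tensorInnerₛₗ_apply, horth α.2 β.2 fun h => hβ (Subtype.ext h.symm), smul_zero]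
    · exact fun h => absurd hα h
  · rw [symmetryClass_eq_span b]
    refine le_antisymm (Submodule.span_mono (Set.image_subset_range _ _)) ?_
    rw [Submodule.span_le]
    rintro _ ⟨β, rfl⟩
    obtain ⟨g, hg⟩ : ∃ g : G, β = permAct g (Quotient.mk r β).out := Quotient.mk_out (s := r) β
    rw [hg, hact]
    refine Submodule.smul_mem _ _ ?_
    by_cases h0 : starTensor b G χ (Quotient.mk r β).out = 0
    · rw [h0]
      exact zero_mem _
    · exact Submodule.subset_span ⟨_, ⟨h0, by rw [Quotient.out_eq]⟩, rfl⟩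


/-! ### From o*-bases to degree one in the three cases -/

theorem character_mul_of_finrank_eq_one {G W : Type*} [Group G] [AddCommGroup W] [Module ℂ W]
    {ρ : Representation ℂ G W} (h1 : finrank ℂ W = 1) (g h : G) :
    ρ.character (g * h) = ρ.character g * ρ.character h := by
  have := Module.finite_of_finrank_pos (R := ℂ) (M := W) (by omega)
  obtain ⟨a, ha, -⟩ := LinearMap.existsUnique_eq_smul_id_of_finrank_eq_one h1 (ρ g)
  obtain ⟨c, hc, -⟩ := LinearMap.existsUnique_eq_smul_id_of_finrank_eq_one h1 (ρ h)
  simp only [Representation.character, map_mul, ha, hc]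
  simp [h1, ← Module.End.one_eq_id, mul_comm]

theorem finrank_eq_one_of_hasOStarBasis {G : Subgroup (Equiv.Perm (Fin m))} {d : ℕ}
    {ρ : Representation ℂ G (Fin d → ℂ)} [ρ.IsIrreducible] {b : OrthonormalBasis (Fin n) ℂ V}
    (c : G) [hc : (Subgroup.zpowers c).Normal] [IsCyclic (G ⧸ Subgroup.zpowers c)]
    (hsum : ∀ s : Multiset ℂ, s.card = finrank ℂ (Fin d → ℂ) → (∀ z ∈ s, z ^ orderOf c = 1) →
      s.sum ≠ 0)
    {α : Fin m → Fin n} (hα : ∀ h ∈ ρ.commuteSubgroup c, permAct h α = α → h = 1)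
    (hS : HasOStarBasis b G ρ.character) : finrank ℂ (Fin d → ℂ) = 1 := by
  have hn : ∀ g : G, g * c * g⁻¹ ∈ Subgroup.zpowers c := fun g =>
    hc.conj_mem c (Subgroup.mem_zpowers c) g
  have hcomm : ∀ g t : G, g * t * g⁻¹ * t⁻¹ ∈ Subgroup.zpowers c := by
    intro g t
    have := IsCyclic.isMulCommutative (α := G ⧸ Subgroup.zpowers c)
    rw [← QuotientGroup.eq_one_iff]
    have h1 : (g : G ⧸ Subgroup.zpowers c) * t = t * g := this.is_comm.comm _ _
    rw [QuotientGroup.mk_mul, QuotientGroup.mk_mul, QuotientGroup.mk_mul, h1, QuotientGroup.mk_inv,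
      QuotientGroup.mk_inv]
    simp
  have hT : (ρ.commuteSubgroup c).Normal :=
    ⟨fun t ht g => Representation.commuteSubgroup_conj_mem hn ht g⟩
  have hzero : ∀ g, ρ.character g = 0 ↔ g ∉ ρ.commuteSubgroup c := fun g =>
    ⟨fun h hg => Representation.character_ne_zero_of_mem_commuteSubgroup hcomm hsum hg h,
      fun hg => Representation.IsIrreducible.character_eq_zero hn hg⟩
  have hcT : c ∈ ρ.commuteSubgroup c :=
    Representation.zpowers_le_commuteSubgroup c (Subgroup.mem_zpowers c)
  obtain ⟨μ, hμ⟩ := hS.exists_character_mul hzero hα c hcT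
  obtain ⟨v, hv⟩ := Representation.IsIrreducible.exists_ne_zero (ρ := ρ)
  have : Nontrivial (Fin d → ℂ) := ⟨⟨v, 0, hv⟩⟩
  have hscal : ρ c = μ • 1 := Representation.exists_eq_smul_one_of_character_mul fun j => by
    rw [pow_succ]
    exact hμ _ (pow_mem hcT j)
  have htop : ρ.commuteSubgroup c = ⊤ := by
    refine eq_top_iff.2 fun g _ => ?_
    rw [Representation.mem_commuteSubgroup, hscal]
    exact (Commute.one_right _).smul_right μ
  rw [Representation.finrank_eq_index_commuteSubgroup (ρ := ρ) c, htop, Subgroup.index_top]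

/-- A commutative permutation group has a two-colouring that only the identity preserves. -/
theorem exists_permAct_eq_imp_eq_one (hn : 1 < n) (A : Subgroup (Equiv.Perm (Fin m)))
    (hA : ∀ x ∈ A, ∀ y ∈ A, x * y = y * x) :
    ∃ α : Fin m → Fin n, ∀ h ∈ A, permAct h α = α → h = 1 := by
  classical
  let r : Setoid (Fin m) :=
    { r := fun i j => ∃ a ∈ A, j = a i
      iseqv := ⟨fun i => ⟨1, A.one_mem, rfl⟩, by
        rintro i _ ⟨a, ha, rfl⟩
        exact ⟨a⁻¹, A.inv_mem ha, by simp⟩, by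
        rintro i _ _ ⟨a, ha, rfl⟩ ⟨c, hc, rfl⟩
        exact ⟨c * a, A.mul_mem hc ha, rfl⟩⟩ }
  -- One point of each orbit gets its own colour. A colour-preserving `h` fixes that point, and by
  -- commutativity the whole orbit.
  refine ⟨fun i => if (Quotient.mk r i).out = i then ⟨0, by omega⟩ else ⟨1, hn⟩,
    fun h hh hfix => inv_eq_one.1 (Equiv.ext fun i => ?_)⟩
  obtain ⟨a, ha, hai⟩ : ∃ a ∈ A, i = a (Quotient.mk r i).out := Quotient.mk_out (s := r) i
  set j := (Quotient.mk r i).out with hj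
  have h1 : (Quotient.mk r j).out = j := by rw [hj, Quotient.out_eq]
  have h2 : (Quotient.mk r (h⁻¹ j)).out = h⁻¹ j := by
    have h3 := congrFun hfix j
    simp only [permAct, h1, if_true] at h3
    by_contra hne
    rw [if_neg hne] at h3
    simp at h3
  have h3 : Quotient.mk r (h⁻¹ j) = Quotient.mk r j :=
    Quotient.sound (s := r) ⟨h, hh, by simp⟩
  rw [h3, h1] at h2
  conv_lhs => rw [hai, ← Equiv.Perm.mul_apply, hA _ (A.inv_mem hh) _ ha, Equiv.Perm.mul_apply, ← h2]
  exact hai.symm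

/-- When `⟨c⟩` has prime index, the colouring condition is automatic. -/
theorem exists_permAct_commuteSubgroup (hn : 1 < n) {G : Subgroup (Equiv.Perm (Fin m))} {d : ℕ}
    {ρ : Representation ℂ G (Fin d → ℂ)} [ρ.IsIrreducible]
    (c : G) [hc : (Subgroup.zpowers c).Normal] [IsCyclic (G ⧸ Subgroup.zpowers c)]
    (hprime : (Subgroup.zpowers c).index.Prime) (hd : finrank ℂ (Fin d → ℂ) ≠ 1) :
    ∃ α : Fin m → Fin n, ∀ h ∈ ρ.commuteSubgroup c, permAct h α = α → h = 1 := by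
  have hle : Subgroup.zpowers c ≤ ρ.commuteSubgroup c :=
    Representation.zpowers_le_commuteSubgroup c
  -- The index of `commuteSubgroup` is the degree, which is not `1` and divides a prime; so the
  -- subgroup is `⟨c⟩` itself, which is abelian.
  have hT : ρ.commuteSubgroup c ≤ Subgroup.zpowers c := by
    rw [Representation.finrank_eq_index_commuteSubgroup (ρ := ρ) c] at hd
    rw [← Subgroup.relIndex_eq_one]
    have h1 := Subgroup.relIndex_mul_index hle
    rcases (Nat.dvd_prime hprime).1 (Subgroup.index_dvd_of_le hle) with h | h
    · exact absurd h hd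
    · rw [h] at h1
      exact Nat.eq_of_mul_eq_mul_right hprime.pos (by rw [h1, one_mul])
  obtain ⟨α, hα⟩ := exists_permAct_eq_imp_eq_one (n := n) hn
    (Subgroup.zpowers (c : Equiv.Perm (Fin m))) (by
      rintro _ ⟨i, rfl⟩ _ ⟨j, rfl⟩
      exact ((Commute.refl _).zpow_zpow i j).eq)
  refine ⟨α, fun h hh hfix => Subtype.ext (hα h ?_ hfix)⟩
  obtain ⟨i, rfl⟩ := hT hh
  exact ⟨i, by simp⟩

theorem finrank_eq_one_of_dihedral (hn : 1 < n) {G : Subgroup (Equiv.Perm (Fin m))} {d s : ℕ}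
    {ρ : Representation ℂ G (Fin d → ℂ)} [ρ.IsIrreducible] {b : OrthonormalBasis (Fin n) ℂ V}
    (hs : Odd s) (e : G ≃* DihedralGroup s) (hS : HasOStarBasis b G ρ.character) :
    finrank ℂ (Fin d → ℂ) = 1 := by
  by_contra hd
  set c := e.symm (DihedralGroup.r 1) with hcdef
  have hord : orderOf c = s := by
    rw [hcdef, MulEquiv.orderOf_eq, DihedralGroup.orderOf_r_one]
  have hs0 : 0 < s := hs.pos
  have hindex : (Subgroup.zpowers c).index = 2 := by
    have h1 := Subgroup.card_mul_index (Subgroup.zpowers c)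
    rw [Nat.card_zpowers, hord, Nat.card_congr e.toEquiv, DihedralGroup.nat_card, mul_comm 2] at h1
    exact Nat.eq_of_mul_eq_mul_left hs0 h1
  have hnorm := Subgroup.normal_of_index_eq_two hindex
  have : Fact (Nat.Prime 2) := ⟨Nat.prime_two⟩
  have hcyc : IsCyclic (G ⧸ Subgroup.zpowers c) := isCyclic_of_prime_card (p := 2) hindex
  obtain ⟨α, hα⟩ := exists_permAct_commuteSubgroup (ρ := ρ) hn c (hindex ▸ Nat.prime_two) hd
  refine hd (finrank_eq_one_of_hasOStarBasis c (fun t ht hz => ?_) hα hS)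
  have h2 : finrank ℂ (Fin d → ℂ) ∣ 2 := by
    rw [Representation.finrank_eq_index_commuteSubgroup (ρ := ρ) c, ← hindex]
    exact Subgroup.index_dvd_of_le (Representation.zpowers_le_commuteSubgroup c)
  rw [hord] at hz
  refine Multiset.sum_ne_zero_of_card_le_two hs hz ?_ (ht ▸ Nat.le_of_dvd two_pos h2)
  rintro rfl
  rw [← ht] at h2
  simp at h2

/-- In a `Z`-group whose order has two prime divisors, the commutator subgroup is a Sylow subgroup
if it is a nontrivial proper subgroup. -/
theorem exists_card_commutator_eq_prime_pow {G : Type*} [Group G] [Finite G] [IsZGroup G]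
    (hcard : (Nat.card G).primeFactors.card = 2) (h1 : Nat.card (commutator G) ≠ 1)
    (h2 : (commutator G).index ≠ 1) :
    ∃ p a : ℕ, p.Prime ∧ Nat.card (commutator G) = p ^ a ∧ ¬ p ∣ (commutator G).index := by
  have hcop := IsZGroup.coprime_commutator_index G
  have h3 : (commutator G).index ≠ 0 := Subgroup.index_ne_zero_of_finite
  have h4 : Nat.card (commutator G) ≠ 0 := Nat.card_pos.ne'
  -- Order and index of the commutator subgroup are coprime and nontrivial, so each takes exactly
  -- one of the two primes.
  rw [← Subgroup.card_mul_index (commutator G), hcop.primeFactors_mul,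
    Finset.card_union_of_disjoint hcop.disjoint_primeFactors] at hcard
  have h5 : 0 < (commutator G).index.primeFactors.card :=
    Finset.card_pos.2 (Nat.nonempty_primeFactors.2 (by omega))
  have h6 : 0 < (Nat.card (commutator G)).primeFactors.card :=
    Finset.card_pos.2 (Nat.nonempty_primeFactors.2 (by omega))
  obtain ⟨p, a, hp, ha, hpa⟩ := (isPrimePow_nat_iff _).1
    (isPrimePow_iff_card_primeFactors_eq_one.2
      (by omega : (Nat.card (commutator G)).primeFactors.card = 1))
  refine ⟨p, a, hp, hpa.symm, fun hdvd => hp.one_lt.ne' ?_⟩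
  exact Nat.eq_one_of_dvd_coprimes hcop (hpa ▸ dvd_pow_self p ha.ne') hdvd

/-- Take `c` generating the commutator subgroup: its order is a power of `p`, and the degree divides
the index, which is prime to `p`. The second alternative in `hα` serves groups of order `pq`, where
the colouring comes for free. -/
theorem finrank_eq_one_of_isZGroup {G : Subgroup (Equiv.Perm (Fin m))} {d : ℕ}
    {ρ : Representation ℂ G (Fin d → ℂ)} [ρ.IsIrreducible] {b : OrthonormalBasis (Fin n) ℂ V}
    [IsZGroup G] (hcard : (Nat.card G).primeFactors.card = 2)
    (hα : (∃ α : Fin m → Fin n, ∀ h : G, permAct h α = α → h = 1) ∨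
      1 < n ∧ ((commutator G).index ≠ 1 → Nat.card (commutator G) ≠ 1 →
        (commutator G).index.Prime))
    (hS : HasOStarBasis b G ρ.character) : finrank ℂ (Fin d → ℂ) = 1 := by
  by_contra hd
  have hcyc := IsZGroup.isCyclic_commutator (G := G)
  obtain ⟨c, hc⟩ := (Subgroup.isCyclic_iff_exists_zpowers_eq_top (commutator G)).1 hcyc
  have hnorm : (Subgroup.zpowers c).Normal := hc ▸ inferInstance
  have hcycq : IsCyclic (G ⧸ Subgroup.zpowers c) :=
    have : IsCyclic (G ⧸ commutator G) := IsZGroup.isCyclic_abelianization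
    isCyclic_of_surjective _ (QuotientGroup.quotientMulEquivOfEq hc.symm).surjective
  have hfin := Representation.finrank_eq_index_commuteSubgroup (ρ := ρ) c
  have hdvd : finrank ℂ (Fin d → ℂ) ∣ (commutator G).index := by
    rw [hfin, ← hc]
    exact Subgroup.index_dvd_of_le (Representation.zpowers_le_commuteSubgroup c)
  have h2 : (commutator G).index ≠ 1 := fun h => hd (Nat.dvd_one.1 (h ▸ hdvd))
  have h1 : Nat.card (commutator G) ≠ 1 := by
    rw [← hc, Nat.card_zpowers, Ne, orderOf_eq_one_iff]
    rintro rfl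
    refine hd (hfin.trans (Subgroup.index_eq_one.2 (eq_top_iff.2 fun g _ => ?_)))
    rw [Representation.mem_commuteSubgroup, map_one]
    exact Commute.one_right _
  obtain ⟨p, a, hp, hpa, hpi⟩ := exists_card_commutator_eq_prime_pow hcard h1 h2
  obtain ⟨α, hα⟩ : ∃ α : Fin m → Fin n,
      ∀ h ∈ ρ.commuteSubgroup c, permAct h α = α → h = 1 := by
    rcases hα with ⟨α, hα⟩ | ⟨hn, hprime⟩
    · exact ⟨α, fun h _ => hα h⟩
    · exact exists_permAct_commuteSubgroup hn c (hc ▸ hprime h2 h1) hd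
  refine hd (finrank_eq_one_of_hasOStarBasis c (fun t ht hz => ?_) hα hS)
  rw [← Nat.card_zpowers, hc, hpa] at hz
  refine Multiset.sum_ne_zero_of_prime_pow hp hz fun h => hpi ?_
  rw [ht] at h
  exact h.trans hdvd

theorem prime_right_of_mul_eq_mul_primes {p q x y : ℕ} (hp : p.Prime) (hq : q.Prime)
    (h : x * y = p * q) (hx : x ≠ 1) (hy : y ≠ 1) : y.Prime := by
  rcases (hp.dvd_mul).1 (Dvd.intro q h.symm) with ⟨c, rfl⟩ | ⟨c, rfl⟩
  · rw [mul_assoc] at h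
    have h1 := Nat.eq_of_mul_eq_mul_left hp.pos h
    rcases (Nat.dvd_prime hq).1 (Dvd.intro_left c h1) with h2 | h2
    · exact absurd h2 hy
    · exact h2 ▸ hq
  · rw [mul_left_comm] at h
    have h1 := Nat.eq_of_mul_eq_mul_left hp.pos h
    rcases (Nat.dvd_prime hq).1 (Dvd.intro c h1) with h2 | h2
    · exact absurd h2 hx
    · rw [h2] at h1
      rw [Nat.eq_of_mul_eq_mul_left hq.pos (h1.trans (mul_one q).symm), mul_one]
      exact hp

end SymTensor

end

theorem mainTheorem3 {V : Type*} [NormedAddCommGroup V] [InnerProductSpace ℂ V] {n m : ℕ}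
    (hn : 1 < n) (b : OrthonormalBasis (Fin n) ℂ V) (G : Subgroup (Equiv.Perm (Fin m)))
    (hG : (∃ s : ℕ, Odd s ∧ Nonempty (G ≃* DihedralGroup s)) ∨
      (∃ p q : ℕ, p.Prime ∧ q.Prime ∧ Nat.card G = p * q ∧ ¬ ∀ x y : G, x * y = y * x) ∨
      (IsZGroup G ∧ (Nat.card G).primeFactors.card = 2 ∧
        ∃ α : Fin m → Fin n, SymTensor.stabilizer G α = {1}))
    (χ : G → ℂ) (hχ : SymTensor.IsIrreducibleCharacter χ) :
    SymTensor.HasOStarBasis b G χ ↔ SymTensor.IsLinearCharacter χ := by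
  obtain ⟨d, ρ, hρ, rfl⟩ := hχ
  constructor
  · intro hS
    rw [SymTensor.IsLinearCharacter, Representation.char_one, Nat.cast_eq_one]
    rcases hG with ⟨s, hs, ⟨e⟩⟩ | ⟨p, q, hp, hq, hcard, hcomm⟩ | ⟨hZ, hcard, α, hα⟩
    · exact SymTensor.finrank_eq_one_of_dihedral hn hs e hS
    -- A group of order `p²` is abelian, so the order is squarefree and `G` is a `Z`-group.
    · have hpq : p ≠ q := by
        rintro rfl
        have : Fact p.Prime := ⟨hp⟩
        have := IsPGroup.isMulCommutative_of_card_eq_prime_sq (G := G) (p := p)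
          (by rw [hcard, sq])
        exact hcomm fun x y => this.is_comm.comm x y
      have hcop : p.Coprime q := (Nat.coprime_primes hp hq).2 hpq
      have hZ : IsZGroup G := IsZGroup.of_squarefree (by
        rw [hcard]
        exact Nat.squarefree_mul_iff.2 ⟨hcop, hp.squarefree, hq.squarefree⟩)
      refine SymTensor.finrank_eq_one_of_isZGroup ?_ (Or.inr ⟨hn, fun h2 h1 => ?_⟩) hS
      · rw [hcard, hcop.primeFactors_mul, Finset.card_union_of_disjoint hcop.disjoint_primeFactors,
          hp.primeFactors, hq.primeFactors, Finset.card_singleton, Finset.card_singleton]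
      · exact SymTensor.prime_right_of_mul_eq_mul_primes hp hq
          ((Subgroup.card_mul_index (commutator G)).trans hcard) h1 h2
    · refine SymTensor.finrank_eq_one_of_isZGroup hcard (Or.inl ⟨α, fun h hh => ?_⟩) hS
      have h1 : (h : Equiv.Perm (Fin m)) ∈ SymTensor.stabilizer G α := ⟨h.2, hh⟩
      rw [hα] at h1
      exact Subtype.ext h1
  · intro h
    have hd : Module.finrank ℂ (Fin d → ℂ) = 1 := by
      rwa [SymTensor.IsLinearCharacter, Representation.char_one, Nat.cast_eq_one] at h
    exact SymTensor.hasOStarBasis_of_map_mul b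
      (SymTensor.character_mul_of_finrank_eq_one hd) h
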